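/- Let $\mathrm{TFAB}_\omega$ be the set of all torsion-free abelian groups with domain $\omega=\mathbb{N}$, each identified with its addition table in $\omega^{\omega\times\omega}$; with the Borel structure inherited from the product space $\omega^{\omega\times\omega}$ ($\omega$ discrete) it is a standard Borel space. An abelian group $G$ is called rigid if $\mathrm{Aut}(G)=\{\mathrm{id}_G,-\mathrm{id}_G\}$. Then the set $R$ of rigid groups is complete co-analytic in $\mathrm{TFAB}_\omega$. That is, $R$ is co-analytic (its complement is an analytic subset of $\mathrm{TFAB}_\omega$), and for every standard Borel space $Y$ and every co-analytic set $B\subseteq Y$ there is a Borel map $f\colon Y\to\mathrm{TFAB}_\omega$ with $f^{-1}(R)=B$. -/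

import Mathlib

open MeasureTheory

/-- `m` is the addition of a torsion-free abelian group with domain `ω = ℕ`. Here `(m a)^[n] e` is
the `n`-th multiple `n • a` of `a`, where `e` is the neutral element. -/
structure IsTFABOp (m : ℕ → ℕ → ℕ) : Prop where
  assoc : ∀ a b c, m (m a b) c = m a (m b c)
  comm : ∀ a b, m a b = m b a
  exists_zero : ∃ e, (∀ a, m e a = a) ∧ (∀ a, ∃ b, m b a = e) ∧
    ∀ n a, (m a)^[n + 1] e = e → a = e

/-- The space `TFAB_ω` of torsion-free abelian groups with domain `ω`, a group being identified
with its addition table. Its Borel structure is inherited from the product space `ω^(ω × ω)`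
(the subtype instance). -/
abbrev TFAB : Type := {m : ℕ → ℕ → ℕ // IsTFABOp m}

theorem measurable_apply_nat {X : Type*} [MeasurableSpace X] {g : X → ℕ → ℕ} {h : X → ℕ}
    (hg : Measurable g) (hh : Measurable h) : Measurable fun x => g x (h x) := by
  have hp : Measurable fun p : ℕ × (ℕ → ℕ) => p.2 p.1 :=
    measurable_from_prod_countable_right fun n => measurable_pi_apply n
  exact hp.comp (hh.prodMk hg)

theorem measurableSet_isTFABOp : MeasurableSet {m : ℕ → ℕ → ℕ | IsTFABOp m} := by
  have ev : ∀ {f g : (ℕ → ℕ → ℕ) → ℕ}, Measurable f → Measurable g →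
      Measurable fun m : ℕ → ℕ → ℕ => m (f m) (g m) := by
    intro f g hf hg
    have hp : Measurable fun p : ℕ × (ℕ → ℕ → ℕ) => p.2 p.1 :=
      measurable_from_prod_countable_right fun n => measurable_pi_apply n
    exact measurable_apply_nat (hp.comp (hf.prodMk measurable_id)) hg
  have eq : ∀ {f g : (ℕ → ℕ → ℕ) → ℕ}, Measurable f → Measurable g →
      Measurable fun m : ℕ → ℕ → ℕ => f m = g m := fun hf hg =>
    measurableSet_setOfPred.1 (measurableSet_eq_fun hf hg)
  have it : ∀ a e n, Measurable fun m : ℕ → ℕ → ℕ => (m a)^[n] e := by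
    intro a e n
    induction n with
    | zero => exact measurable_const
    | succ n ih =>
      simp only [Function.iterate_succ_apply']
      exact ev measurable_const ih
  have key : {m : ℕ → ℕ → ℕ | IsTFABOp m} = {m | (∀ a b c, m (m a b) c = m a (m b c)) ∧
      (∀ a b, m a b = m b a) ∧ ∃ e, (∀ a, m e a = a) ∧ (∀ a, ∃ b, m b a = e) ∧
        ∀ n a, (m a)^[n + 1] e = e → a = e} :=
    Set.ext fun m => ⟨fun h => ⟨h.1, h.2, h.3⟩, fun h => ⟨h.1, h.2.1, h.2.2⟩⟩
  rw [key, measurableSet_setOfPred]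
  refine Measurable.and ?_ (Measurable.and ?_ (Measurable.exists fun e =>
    Measurable.and ?_ (Measurable.and ?_ ?_)))
  · exact Measurable.forall fun a => Measurable.forall fun b => Measurable.forall fun c =>
      eq (ev (ev measurable_const measurable_const) measurable_const)
        (ev measurable_const (ev measurable_const measurable_const))
  · exact Measurable.forall fun a => Measurable.forall fun b =>
      eq (ev measurable_const measurable_const) (ev measurable_const measurable_const)
  · exact Measurable.forall fun a => eq (ev measurable_const measurable_const) measurable_const
  · exact Measurable.forall fun a => Measurable.exists fun b =>
      eq (ev measurable_const measurable_const) measurable_const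
  · exact Measurable.forall fun n => Measurable.forall fun a =>
      (eq (it a e (n + 1)) measurable_const).imp measurable_const

/-- `TFAB_ω` is a Borel subset of `ω^(ω × ω)`, hence a standard Borel space. -/
instance : StandardBorelSpace TFAB := measurableSet_isTFABOp.standardBorel

/-- The underlying type `ω` of `G`, as a type synonym that carries the group structure of `G`. -/
def TFAB.Carrier (_G : TFAB) : Type := ℕ

instance (G : TFAB) : Add G.Carrier where
  add := G.1

noncomputable instance (G : TFAB) : Zero G.Carrier where
  zero := G.2.exists_zero.choose

noncomputable instance (G : TFAB) : Neg G.Carrier where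
  neg a := (G.2.exists_zero.choose_spec.2.1 a).choose

noncomputable instance (G : TFAB) : AddCommGroup G.Carrier where
  add_assoc := G.2.assoc
  add_comm := G.2.comm
  zero_add := G.2.exists_zero.choose_spec.1
  add_zero a := (G.2.comm _ _).trans (G.2.exists_zero.choose_spec.1 a)
  neg_add_cancel a := (G.2.exists_zero.choose_spec.2.1 a).choose_spec
  nsmul := nsmulRec
  zsmul := zsmulRec

/-- An abelian group is rigid if its automorphisms are exactly `id` and `-id`. -/
def IsRigid (A : Type*) [AddCommGroup A] : Prop :=
  (Set.univ : Set (A ≃+ A)) = {AddEquiv.refl A, AddEquiv.neg A}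

/-- Analytic subsets of a standard Borel space: those that are analytic for a Polish topology
inducing the Borel structure. (The choice of this topology does not matter.) -/
def IsAnalytic {X : Type*} [MeasurableSpace X] (s : Set X) : Prop :=
  ∃ _ : TopologicalSpace X, PolishSpace X ∧ BorelSpace X ∧ AnalyticSet s

/-- Co-analytic subsets: complements of analytic ones. -/
def IsCoanalytic {X : Type*} [MeasurableSpace X] (s : Set X) : Prop :=
  IsAnalytic sᶜ

universe u v

/-- A subset `A` of a standard Borel space is complete co-analytic if it is co-analytic and every
co-analytic subset of every standard Borel space is the preimage of `A` under a Borel map. -/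
def IsCompleteCoanalytic {X : Type u} [MeasurableSpace X] [StandardBorelSpace X]
    (A : Set X) : Prop :=
  IsCoanalytic A ∧
    ∀ (Y : Type v) [MeasurableSpace Y] [StandardBorelSpace Y] (B : Set Y), IsCoanalytic B →
      ∃ f : Y → X, Measurable f ∧ f ⁻¹' A = B

/-! A Borel set-up describes non-rigidity by the existence of an automorphism other than ±id, coded
in a Polish space, so the rigid groups are co-analytic. For hardness, an analytic set is presented
by a Borel family of trees, and each tree `T` is coded by a group that is rigid exactly when `T` has
no infinite branch.

The group lies in the rational space on vectors e_n (levels) and e_s (finite sequences). For each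
label j, the vectors of the group killed by the j-th collapsing map are p_j-divisible to all orders,
hence every endomorphism preserves that kernel (`collapse_eq_zero_of_hom`). The kernels are: `node
t`, spanned by e_t; `link t`, by e_t - e_[]; `level n`, by e_n and the e_s with s in `T` of length
n; `step n`, by e_{n+1} - e_n and the e_{k :: s} - e_s with s of length n; `base`, by e_1 - e_[] and
the e_s with s of length 1.

A branch x gives the square-zero map e_n ↦ e_{x|n}, e_s ↦ 0, which preserves all kernels, so 1 + ν
is an extra automorphism. Conversely an endomorphism multiplies all e_s by one scalar l and sends
e_n to l e_n plus nodes of `T` of length n; `step` forces each such node to have a child in the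
image of e_{n+1}, so without branches the endomorphism is l. As every prime carries a label, l is an
integer, and for an automorphism l = ±1. -/

/-! ### Rationals integral at a prime -/

/-- The ring of rationals that are integral at the prime `p`. -/
def primeIntegral (p : Nat.Primes) : Subring ℚ where
  carrier := {q | ¬ (p : ℕ) ∣ q.den}
  zero_mem' := by simpa using p.2.one_lt.ne'
  one_mem' := by simpa using p.2.one_lt.ne'
  neg_mem' := by simp
  add_mem' {a b} ha hb h := (p.2.dvd_mul.1 (h.trans (Rat.add_den_dvd a b))).elim ha hb
  mul_mem' {a b} ha hb h := (p.2.dvd_mul.1 (h.trans (Rat.mul_den_dvd a b))).elim ha hb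

theorem mem_primeIntegral {p : Nat.Primes} {q : ℚ} :
    q ∈ primeIntegral p ↔ ¬ (p : ℕ) ∣ q.den := Iff.rfl

theorem inv_prime_pow_mem_primeIntegral {p q : Nat.Primes} (h : p ≠ q) (k : ℕ) :
    ((q : ℚ) ^ k)⁻¹ ∈ primeIntegral p := by
  rw [← inv_pow]
  refine pow_mem ?_ k
  rw [mem_primeIntegral, Rat.inv_natCast_den_of_pos q.2.pos]
  exact fun h' => h (Subtype.ext ((Nat.prime_dvd_prime_iff_eq p.2 q.2).1 h'))

theorem eq_zero_of_forall_prime_pow {p : Nat.Primes} {q : ℚ}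
    (h : ∀ k : ℕ, ∃ r ∈ primeIntegral p, q = (p : ℚ) ^ k * r) : q = 0 := by
  have hdvd : ∀ k : ℕ, ((p : ℕ) ^ k) ∣ q.num.natAbs := by
    intro k
    obtain ⟨r, hr, e⟩ := h k
    have e1 : q.num * r.den = ((p : ℕ) : ℤ) ^ k * r.num * q.den := by
      have hq := Rat.num_div_den q
      have hr' := Rat.num_div_den r
      have h1 : (q.den : ℚ) ≠ 0 := by exact_mod_cast q.den_nz
      have h2 : (r.den : ℚ) ≠ 0 := by exact_mod_cast r.den_nz
      rw [← hq, ← hr'] at e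
      field_simp at e
      have e' : q.num * (r.den : ℤ) = (q.den : ℤ) * (p : ℕ) ^ k * r.num := by exact_mod_cast e
      rw [e']; ring
    have e2 : (p : ℕ) ^ k ∣ q.num.natAbs * r.den := by
      have := congrArg Int.natAbs e1
      simp only [Int.natAbs_mul, Int.natAbs_pow, Int.natAbs_natCast] at this
      rw [this, mul_assoc]
      exact dvd_mul_right _ _
    exact (Nat.Coprime.pow_left k ((Nat.Prime.coprime_iff_not_dvd p.2).2 hr)).dvd_of_dvd_mul_right e2
  by_contra h0
  have h1 : 0 < q.num.natAbs := Int.natAbs_pos.2 (Rat.num_ne_zero.2 h0)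
  exact absurd (Nat.le_of_dvd h1 (hdvd q.num.natAbs)) (not_le.2 (Nat.lt_pow_self p.2.one_lt))

theorem exists_int_of_forall_mem_primeIntegral {q : ℚ} (h : ∀ p, q ∈ primeIntegral p) :
    ∃ z : ℤ, q = z := by
  refine ⟨q.num, (Rat.den_eq_one_iff q).1 ?_ |>.symm⟩
  by_contra h1
  obtain ⟨p, hp, hd⟩ := Nat.exists_prime_and_dvd h1
  exact h ⟨p, hp⟩ hd

/-! ### Groups cut out by collapsing maps -/

section Collapse

variable {I : Type*}

/-- The linear map that sends each basis vector `i` to the basis vector `κ i`, or to `0` if `κ i`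
is undefined. -/
noncomputable def collapse (κ : I → Option I) : (I →₀ ℚ) →ₗ[ℚ] (I →₀ ℚ) :=
  Finsupp.linearCombination ℚ fun i => (κ i).elim 0 fun k => Finsupp.single k 1

theorem collapse_single (κ : I → Option I) (i : I) (q : ℚ) :
    collapse κ (Finsupp.single i q) = (κ i).elim 0 fun k => Finsupp.single k q := by
  rw [collapse, Finsupp.linearCombination_single]
  cases κ i <;> simp

theorem collapse_single_some {κ : I → Option I} {i k : I} (h : κ i = some k) (q : ℚ) :
    collapse κ (Finsupp.single i q) = Finsupp.single k q := by
  simp [collapse_single, h]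

theorem collapse_single_none {κ : I → Option I} {i : I} (h : κ i = none) (q : ℚ) :
    collapse κ (Finsupp.single i q) = 0 := by
  simp [collapse_single, h]

theorem collapse_comp (κ η : I → Option I) (v : I →₀ ℚ) :
    collapse κ (collapse η v) = collapse (fun i => (η i).bind κ) v := by
  induction v using Finsupp.induction_linear with
  | zero => simp
  | add f g hf hg => simp [hf, hg]
  | single i q =>
    rw [collapse_single, collapse_single]
    cases η i <;> simp [collapse_single]

theorem collapse_mem (κ : I → Option I) (R : Subring ℚ) {v : I →₀ ℚ} (hv : ∀ i, v i ∈ R) (k : I) :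
    collapse κ v k ∈ R := by
  rw [collapse, Finsupp.linearCombination_apply, Finsupp.sum, Finsupp.finsetSum_apply]
  refine sum_mem fun i _ => ?_
  rw [Finsupp.smul_apply, smul_eq_mul]
  refine mul_mem (hv i) ?_
  cases κ i with
  | none => simp
  | some l =>
    classical
    simp only [Option.elim, Finsupp.single_apply]
    split_ifs
    exacts [one_mem _, zero_mem _]

/-- The coefficient at k of the collapsed vector is the sum of v over the fibre of k; a vanishing
sum cannot have exactly one nonzero term. -/
theorem exists_ne_of_collapse_eq_zero {κ : I → Option I} {v : I →₀ ℚ} (h : collapse κ v = 0)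
    {i k : I} (hi : κ i = some k) (hv : v i ≠ 0) : ∃ j ≠ i, κ j = some k ∧ v j ≠ 0 := by
  by_contra! hj
  apply hv
  have h1 := DFunLike.congr_fun h k
  rw [collapse, Finsupp.linearCombination_apply, Finsupp.sum, Finsupp.finsetSum_apply,
    Finset.sum_eq_single i] at h1
  · simpa [hi] using h1
  · intro j _ hji
    by_cases hk : κ j = some k
    · simp [hj j hji hk]
    · cases hl : κ j with
      | none => simp
      | some l =>
        have : l ≠ k := fun e => hk (e ▸ hl)
        simp [this]
  · intro hi'
    simp [Finsupp.notMem_support_iff.1 hi']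

/-- The vectors whose image under the `j`-th collapsing map is integral at the `j`-th prime. -/
noncomputable def collapseGroup {J : Type*} (p : J → Nat.Primes) (κ : J → I → Option I) :
    AddSubgroup (I →₀ ℚ) where
  carrier := {v | ∀ j i, collapse (κ j) v i ∈ primeIntegral (p j)}
  zero_mem' j i := by simp
  add_mem' ha hb j i := by simpa using add_mem (ha j i) (hb j i)
  neg_mem' ha j i := by simpa using ha j i

variable {J : Type*} {p : J → Nat.Primes} {κ : J → I → Option I}

theorem mem_collapseGroup {v : I →₀ ℚ} :
    v ∈ collapseGroup p κ ↔ ∀ j i, collapse (κ j) v i ∈ primeIntegral (p j) := Iff.rfl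

theorem single_mem_collapseGroup (i : I) : Finsupp.single i 1 ∈ collapseGroup p κ := by
  intro j k
  refine collapse_mem _ _ (fun l => ?_) k
  classical
  rw [Finsupp.single_apply]
  split_ifs
  exacts [one_mem _, zero_mem _]

/-- The basis vector `i` as an element of the group. -/
noncomputable def collapseGroup.basis (p : J → Nat.Primes) (κ : J → I → Option I) (i : I) :
    collapseGroup p κ := ⟨Finsupp.single i 1, single_mem_collapseGroup i⟩

theorem collapse_eq_zero_of_hom (hp : Function.Injective p)
    (φ : collapseGroup p κ →+ collapseGroup p κ) {j : J} {v : collapseGroup p κ}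
    (hv : collapse (κ j) v = 0) : collapse (κ j) (φ v) = 0 := by
  ext i
  refine eq_zero_of_forall_prime_pow (p := p j) fun k => ?_
  have hp0 : ((p j : ℕ) : ℚ) ^ k ≠ 0 := pow_ne_zero _ (Nat.cast_ne_zero.2 (p j).2.ne_zero)
  -- Division by a power of p_j is harmless at the other primes, and at p_j there is nothing to
  -- check because the collapsed vector is 0.
  have hw : (((p j : ℕ) : ℚ) ^ k)⁻¹ • (v : I →₀ ℚ) ∈ collapseGroup p κ := by
    intro j' i'
    rw [map_smul, Finsupp.smul_apply, smul_eq_mul]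
    by_cases hj : j' = j
    · subst hj
      simp [hv]
    · exact mul_mem (inv_prime_pow_mem_primeIntegral (fun e => hj (hp e)) k) (v.2 j' i')
  set w : collapseGroup p κ := ⟨(((p j : ℕ) : ℚ) ^ k)⁻¹ • (v : I →₀ ℚ), hw⟩ with hwdef
  have hvw : v = ((p j : ℕ) ^ k) • w := by
    ext1
    rw [AddSubgroup.coe_nsmul, ← Nat.cast_smul_eq_nsmul ℚ]
    rw [hwdef]
    push_cast
    rw [smul_smul, mul_inv_cancel₀ hp0, one_smul]
  refine ⟨collapse (κ j) (φ w) i, (φ w).2 j i, ?_⟩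
  conv_lhs => rw [hvw]
  rw [map_nsmul, AddSubgroup.coe_nsmul, map_nsmul, Finsupp.smul_apply, nsmul_eq_mul]
  push_cast
  rfl

theorem exists_nsmul_mem_closure_basis (v : I →₀ ℚ) : ∃ n : ℕ, n ≠ 0 ∧
    n • v ∈ AddSubgroup.closure (Set.range fun i : I => (Finsupp.single i 1 : I →₀ ℚ)) := by
  induction v using Finsupp.induction_linear with
  | zero => exact ⟨1, one_ne_zero, by simp⟩
  | add f g hf hg =>
    obtain ⟨m, hm, hf⟩ := hf
    obtain ⟨n, hn, hg⟩ := hg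
    refine ⟨m * n, mul_ne_zero hm hn, ?_⟩
    rw [smul_add]
    refine add_mem ?_ ?_
    · rw [mul_comm, mul_smul]
      exact nsmul_mem hf n
    · rw [mul_smul]
      exact nsmul_mem hg m
  | single i q =>
    refine ⟨q.den, q.den_nz, ?_⟩
    have : q.den • (Finsupp.single i q : I →₀ ℚ) = q.num • Finsupp.single i (1 : ℚ) := by
      rw [Finsupp.smul_single, Finsupp.smul_single, nsmul_eq_mul, zsmul_eq_mul, mul_one,
        Rat.den_mul_eq_num]
    rw [this]
    exact zsmul_mem (AddSubgroup.subset_closure (Set.mem_range_self i)) _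

/-- Some nonzero multiple of v is an integral combination of basis vectors, and the ambient space is
torsion-free. -/
theorem hom_eq_smul_of_basis {φ : collapseGroup p κ →+ collapseGroup p κ} {l : ℚ}
    (h : ∀ i, (φ (collapseGroup.basis p κ i) : I →₀ ℚ) = Finsupp.single i l)
    (v : collapseGroup p κ) : (φ v : I →₀ ℚ) = l • (v : I →₀ ℚ) := by
  have key : ∀ w ∈ AddSubgroup.closure (Set.range fun i : I => (Finsupp.single i 1 : I →₀ ℚ)),
      ∃ u : collapseGroup p κ, (u : I →₀ ℚ) = w ∧ (φ u : I →₀ ℚ) = l • w := by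
    intro w hw
    induction hw using AddSubgroup.closure_induction with
    | mem x hx =>
      obtain ⟨i, rfl⟩ := hx
      exact ⟨collapseGroup.basis p κ i, rfl, by rw [h]; simp⟩
    | zero => exact ⟨0, rfl, by simp⟩
    | add x y _ _ hx hy =>
      obtain ⟨a, ha, hx⟩ := hx
      obtain ⟨b, hb, hy⟩ := hy
      exact ⟨a + b, by simp [ha, hb], by simp [hx, hy]⟩
    | neg x _ hx =>
      obtain ⟨a, ha, hx⟩ := hx
      exact ⟨-a, by simp [ha], by simp [hx]⟩
  obtain ⟨n, hn, hnv⟩ := exists_nsmul_mem_closure_basis (v : I →₀ ℚ)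
  obtain ⟨u, hu, hφ⟩ := key _ hnv
  have : u = n • v := Subtype.ext (by rw [hu, AddSubgroup.coe_nsmul])
  rw [this, map_nsmul, AddSubgroup.coe_nsmul, smul_comm] at hφ
  exact (nsmul_right_inj hn).1 hφ

theorem mem_primeIntegral_of_hom {φ : collapseGroup p κ →+ collapseGroup p κ} {l : ℚ}
    (h : ∀ i, (φ (collapseGroup.basis p κ i) : I →₀ ℚ) = Finsupp.single i l)
    {j : J} {i k : I} (hκ : κ j i = some k) : l ∈ primeIntegral (p j) := by
  have := (φ (collapseGroup.basis p κ i)).2 j k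
  rwa [h, collapse_single_some hκ, Finsupp.single_eq_same] at this

/-- If all endomorphisms are scalar, then the group is rigid. -/
theorem isRigid_collapseGroup [Nonempty I] (hp : Function.Surjective p)
    (hκ : ∀ j, ∃ i k, κ j i = some k)
    (h : ∀ φ : collapseGroup p κ →+ collapseGroup p κ, ∃ l : ℚ, ∀ i,
      (φ (collapseGroup.basis p κ i) : I →₀ ℚ) = Finsupp.single i l) :
    IsRigid (collapseGroup p κ) := by
  have hint : ∀ φ : collapseGroup p κ →+ collapseGroup p κ, ∃ z : ℤ, ∀ v,
      (φ v : I →₀ ℚ) = (z : ℚ) • (v : I →₀ ℚ) := by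
    intro φ
    obtain ⟨l, hl⟩ := h φ
    obtain ⟨z, rfl⟩ := exists_int_of_forall_mem_primeIntegral (q := l) fun q => by
      obtain ⟨j, rfl⟩ := hp q
      obtain ⟨i, k, hik⟩ := hκ j
      exact mem_primeIntegral_of_hom hl hik
    exact ⟨z, hom_eq_smul_of_basis hl⟩
  refine (Set.eq_univ_of_forall fun φ => ?_).symm
  obtain ⟨y, hy⟩ := hint φ.toAddMonoidHom
  obtain ⟨z, hz⟩ := hint φ.symm.toAddMonoidHom
  obtain ⟨i⟩ := ‹Nonempty I›
  have h1 : z * y = 1 := by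
    have e := hz (φ (collapseGroup.basis p κ i))
    have e' := hy (collapseGroup.basis p κ i)
    simp only [AddEquiv.toAddMonoidHom_eq_coe, AddMonoidHom.coe_coe, AddEquiv.symm_apply_apply]
      at e e'
    rw [e', smul_smul] at e
    have := DFunLike.congr_fun e i
    simp only [collapseGroup.basis, Finsupp.single_eq_same, Finsupp.smul_apply, smul_eq_mul,
      mul_one] at this
    exact_mod_cast this.symm
  rcases Int.eq_one_or_neg_one_of_mul_eq_one (mul_comm z y ▸ h1) with rfl | rfl
  · left
    ext v : 2
    simpa using hy v
  · right
    ext v : 2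
    simpa using hy v

/-- A square-zero partial map `ν` on basis vectors that is compatible with the collapsing maps
gives a nontrivial automorphism `v ↦ v + ν v`. -/
theorem not_isRigid_collapseGroup {ν : I → Option I} (hν : ∀ i, (ν i).bind ν = none)
    (hκ : ∀ j i, ((κ j i).bind ν).bind (κ j) = (ν i).bind (κ j)) {i k : I} (hi : ν i = some k) :
    ¬ IsRigid (collapseGroup p κ) := by
  have hmem : ∀ v ∈ collapseGroup p κ, collapse ν v ∈ collapseGroup p κ := by
    intro v hv j
    -- By `hκ` the left side depends only on the collapse of v, which is integral at p_j.
    have : collapse (κ j) (collapse ν v) = collapse (κ j) (collapse ν (collapse (κ j) v)) := by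
      simp only [collapse_comp]
      congr 2
      funext i
      rw [← hκ]
    rw [this]
    exact collapse_mem _ _ (collapse_mem _ _ (hv j))
  have hsq : ∀ v, collapse ν (collapse ν v) = 0 := by
    intro v
    rw [collapse_comp]
    simp [hν, collapse, Finsupp.linearCombination_apply]
  let φ : collapseGroup p κ ≃+ collapseGroup p κ :=
    { toFun v := ⟨v + collapse ν v, add_mem v.2 (hmem v v.2)⟩
      invFun v := ⟨v - collapse ν v, sub_mem v.2 (hmem v v.2)⟩
      left_inv v := by ext1; simp [hsq]
      right_inv v := by ext1; simp [hsq]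
      map_add' v w := by ext1; simp only [AddSubgroup.coe_add, map_add]; abel }
  have hφ : (φ (collapseGroup.basis p κ i) : I →₀ ℚ) = Finsupp.single i 1 + Finsupp.single k 1 := by
    simp only [φ, collapseGroup.basis, AddEquiv.coe_mk, Equiv.coe_fn_mk, collapse_single_some hi]
  have hik : i ≠ k := by
    rintro rfl
    have := hν i
    simp [hi] at this
  intro h
  have hm : φ ∈ ({AddEquiv.refl _, AddEquiv.neg _} : Set (collapseGroup p κ ≃+ collapseGroup p κ)) :=
    h ▸ Set.mem_univ φ
  rcases hm with hm | hm <;>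
  · rw [hm] at hφ
    have := DFunLike.congr_fun hφ k
    simp [collapseGroup.basis, hik] at this

end Collapse

/-! ### The group of a tree -/

/-- Labels of the subgroups distinguished in the group of a tree. -/
inductive TreeLabel : Type
  | node (t : List ℕ)
  | link (t : List ℕ)
  | level (n : ℕ)
  | step (n : ℕ)
  | base

namespace TreeLabel

instance : Countable TreeLabel := by
  refine Function.Injective.countable (β := ℕ × List ℕ) (f := fun
    | node t => (0, t)
    | link t => (1, t)
    | level n => (2, [n])
    | step n => (3, [n])
    | base => (4, [])) ?_
  rintro (a | a | a | a | _) (b | b | b | b | _) h <;> simp_all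

instance : Infinite TreeLabel :=
  Infinite.of_injective level fun _ _ h => by injection h

/-- The distinct primes attached to the labels. -/
noncomputable def prime : TreeLabel ≃ Nat.Primes :=
  (nonempty_equiv_of_countable (α := TreeLabel) (β := Nat.Primes)).some

open Classical in
/-- The map that collapses the vectors of the distinguished subgroup to `0`. The basis consists of
one vector for each level and one for each finite sequence, the sequences `k :: s` being the
children of `s`. -/
noncomputable def map (T : Set (List ℕ)) : TreeLabel → ℕ ⊕ List ℕ → Option (ℕ ⊕ List ℕ)
  | node t, i => if i = .inr t then none else some i
  | link t, i => if i = .inr t then some (.inr []) else some i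
  | level n, .inl m => if m = n then none else some (.inl m)
  | level n, .inr s => if s ∈ T ∧ s.length = n then none else some (.inr s)
  | step n, .inl m => some (.inl (if m = n + 1 then n else m))
  | step n, .inr s => some (.inr (if s.length = n + 1 then s.tail else s))
  | base, .inl m => some (if m = 1 then .inr [] else .inl m)
  | base, .inr s => if s.length = 1 then none else some (.inr s)

end TreeLabel

/-- The torsion-free abelian group of a tree `T` of finite sequences. -/
noncomputable abbrev treeGroup (T : Set (List ℕ)) : AddSubgroup (ℕ ⊕ List ℕ →₀ ℚ) :=
  collapseGroup TreeLabel.prime (TreeLabel.map T)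

theorem exists_res_of_chain {T : Set (List ℕ)} (hT : ∀ k s, k :: s ∈ T → s ∈ T)
    {b : ℕ → List ℕ} (hb : ∀ m, ∃ k, b (m + 1) = k :: b m) (hbT : ∀ m, b m ∈ T) :
    ∃ x : ℕ → ℕ, ∀ n, PiNat.res x n ∈ T := by
  generalize h0 : b 0 = s
  induction s generalizing b with
  | nil =>
    choose x hx using hb
    have : ∀ n, PiNat.res x n = b n := by
      intro n
      induction n with
      | zero => simp [h0]
      | succ n ih => rw [PiNat.res_succ, ih, hx]
    exact ⟨x, fun n => this n ▸ hbT n⟩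
  | cons k s ih =>
    -- `PiNat.res` lists the latest entry first, so the parent of k :: s is s; prepending parents
    -- extends the chain back to the root.
    refine ih (b := fun | 0 => s | m + 1 => b m) ?_ ?_ rfl
    · rintro (_ | m)
      · exact ⟨k, h0⟩
      · exact hb m
    · rintro (_ | m)
      · exact hT k s (h0 ▸ hbT 0)
      · exact hbT m

/-- With ν : e_n ↦ e_{x|n}, `level` holds since x|n is in `T` with length n, `step` since x|n is the
tail of x|(n+1), and `base` since it kills x|1. -/
theorem not_isRigid_treeGroup {T : Set (List ℕ)} {x : ℕ → ℕ} (hx : ∀ n, PiNat.res x n ∈ T) :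
    ¬ IsRigid (treeGroup T) := by
  refine not_isRigid_collapseGroup
    (ν := Sum.elim (fun n => some (.inr (PiNat.res x n))) fun _ => none) ?_ ?_
    (i := .inl 0) (k := .inr []) rfl
  · rintro (n | s) <;> rfl
  · rintro (t | t | n | n | _) (m | s) <;>
      simp only [TreeLabel.map, reduceCtorEq, if_false, Sum.inr.injEq, Sum.elim_inl, Sum.elim_inr,
        Option.bind_some, Option.bind_none, PiNat.res_length, hx, true_and]
    · split_ifs <;> rfl
    · split_ifs <;> rfl
    · split_ifs with h
      · rfl
      · simp [TreeLabel.map, h, PiNat.res_length]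
    · split_ifs <;> rfl
    · by_cases h : m = n + 1
      · subst h
        simp
      · simp [h]
    · split_ifs with h
      · rfl
      · simp [TreeLabel.map, h, PiNat.res_length]
    · split_ifs <;> rfl

open TreeLabel in
theorem isRigid_treeGroup {T : Set (List ℕ)} (hT : ∀ k s, k :: s ∈ T → s ∈ T)
    (hwf : ¬ ∃ x : ℕ → ℕ, ∀ n, PiNat.res x n ∈ T) : IsRigid (treeGroup T) := by
  refine isRigid_collapseGroup TreeLabel.prime.surjective ?_ fun φ => ?_
  · rintro (t | t | n | n | _)
    · exact ⟨.inl 0, .inl 0, by simp [TreeLabel.map]⟩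
    · exact ⟨.inl 0, .inl 0, by simp [TreeLabel.map]⟩
    · exact ⟨.inl (n + 1), .inl (n + 1), by simp [TreeLabel.map]⟩
    · exact ⟨.inl 0, _, rfl⟩
    · exact ⟨.inl 0, _, rfl⟩
  set g : ℕ ⊕ List ℕ → (ℕ ⊕ List ℕ →₀ ℚ) := fun i => φ (collapseGroup.basis _ _ i) with hg
  have inv1 : ∀ j i, TreeLabel.map T j i = none → collapse (TreeLabel.map T j) (g i) = 0 := by
    intro j i h
    exact collapse_eq_zero_of_hom TreeLabel.prime.injective φ
      (by simp [collapseGroup.basis, collapse_single_none h])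
  have inv2 : ∀ j i i', TreeLabel.map T j i = TreeLabel.map T j i' →
      collapse (TreeLabel.map T j) (g i - g i') = 0 := by
    intro j i i' h
    have := collapse_eq_zero_of_hom TreeLabel.prime.injective φ (j := j)
      (v := collapseGroup.basis _ _ i - collapseGroup.basis _ _ i')
      (by simp only [collapseGroup.basis, AddSubgroup.coe_sub, map_sub, collapse_single, h, sub_self])
    simpa using this
  set l := g (.inr []) (.inr []) with hl
  have node : ∀ t, g (.inr t) = Finsupp.single (.inr t) (g (.inr t) (.inr t)) := by
    intro t
    ext i
    by_cases hi : i = .inr t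
    · simp [hi]
    rw [Finsupp.single_eq_of_ne hi]
    by_contra h
    obtain ⟨j, hj, hj', -⟩ := exists_ne_of_collapse_eq_zero (inv1 (.node t) (.inr t) (if_pos rfl))
      (i := i) (k := i) (if_neg hi) h
    simp only [TreeLabel.map] at hj'
    split_ifs at hj'
    exact hj (Option.some.inj hj')
  -- Preserving the line of e_t - e_[] makes the two eigenvalues equal.
  have nodes : ∀ t, g (.inr t) = Finsupp.single (.inr t) l := by
    intro t
    by_cases ht : t = []
    · subst ht
      exact node []
    have h := inv2 (link t) (.inr t) (.inr []) (by simp [TreeLabel.map])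
    have e1 : TreeLabel.map T (link t) (.inr t) = some (.inr []) := if_pos rfl
    have e2 : TreeLabel.map T (link t) (.inr []) = some (.inr []) := by simp [TreeLabel.map]
    rw [node t, node [], map_sub, collapse_single_some e1, collapse_single_some e2, ← Finsupp.single_sub] at h
    have := sub_eq_zero.1 (Finsupp.single_eq_zero.1 h)
    rw [node t, this]
  have level_inl : ∀ n m, m ≠ n → g (.inl n) (.inl m) = 0 := by
    intro n m hm
    by_contra h
    obtain ⟨j, hj, hj', -⟩ := exists_ne_of_collapse_eq_zero
      (inv1 (level n) (.inl n) (if_pos rfl)) (i := .inl m) (k := .inl m) (if_neg hm) h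
    rcases j with j | j <;> simp only [TreeLabel.map] at hj' <;> split_ifs at hj'
    · exact hj (Option.some.inj hj')
    · simp at hj'
  have level_inr : ∀ n s, g (.inl n) (.inr s) ≠ 0 → s ∈ T ∧ s.length = n := by
    intro n s h
    by_contra hs
    obtain ⟨j, hj, hj', -⟩ := exists_ne_of_collapse_eq_zero
      (inv1 (level n) (.inl n) (if_pos rfl)) (i := .inr s) (k := .inr s) (if_neg hs) h
    rcases j with j | j <;> simp only [TreeLabel.map] at hj' <;> split_ifs at hj'
    · simp at hj'
    · exact hj (Option.some.inj hj')
  -- The anchor is level 1, not 0: the image of e_0 might involve e_[] itself and spoil the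
  -- comparison, whereas the nodes in the image of e_1 have length 1 and are killed by `base`.
  have coeff_one : g (.inl 1) (.inl 1) = l := by
    have h := inv2 base (.inl 1) (.inr []) rfl
    have h0 : g (.inl 1) (.inr []) = 0 := by
      by_contra h0
      simpa using (level_inr _ _ h0).2
    have e1 : TreeLabel.map T base (.inl 1) = some (.inr []) := rfl
    have e2 : TreeLabel.map T base (.inr []) = some (.inr []) := rfl
    set c := g (.inl 1) (.inl 1)
    -- Subtracting the kernel vector c(e_1 - e_[]) clears the coefficient at e_1 and leaves c - l at
    -- e_[], with nothing in its fibre to cancel it.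
    have h' : collapse (TreeLabel.map T base)
        (g (.inl 1) - g (.inr []) - (Finsupp.single (.inl 1) c - Finsupp.single (.inr []) c)) = 0 := by
      rw [map_sub, h, map_sub, collapse_single_some e1, collapse_single_some e2]
      simp
    by_contra hne
    obtain ⟨j, hj, hj', hj0⟩ := exists_ne_of_collapse_eq_zero h' e2
      (by simpa [h0, nodes, neg_add_eq_zero] using Ne.symm hne)
    rcases j with j | j <;> simp only [TreeLabel.map] at hj' <;> split_ifs at hj'
    · subst j
      exact hj0 (by simp [nodes, c])
    · simp at hj'
    · exact hj (Option.some.inj hj')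
  have coeff_succ : ∀ n, g (.inl (n + 1)) (.inl (n + 1)) = g (.inl n) (.inl n) := by
    intro n
    have h := inv2 (step n) (.inl (n + 1)) (.inl n) (by simp [TreeLabel.map])
    have e1 : TreeLabel.map T (step n) (.inl (n + 1)) = some (.inl n) := by simp [TreeLabel.map]
    have e2 : TreeLabel.map T (step n) (.inl n) = some (.inl n) := by simp [TreeLabel.map]
    set c := g (.inl (n + 1)) (.inl (n + 1)) with hc
    have h' : collapse (TreeLabel.map T (step n))
        (g (.inl (n + 1)) - g (.inl n) -
          (Finsupp.single (.inl (n + 1)) c - Finsupp.single (.inl n) c)) = 0 := by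
      rw [map_sub, h, map_sub, collapse_single_some e1, collapse_single_some e2]
      simp
    by_contra hne
    obtain ⟨j, hj, hj', hj0⟩ := exists_ne_of_collapse_eq_zero h' e2
      (by simpa [level_inl, neg_add_eq_zero] using Ne.symm hne)
    rcases j with j | j <;> simp only [TreeLabel.map] at hj' <;> split_ifs at hj' with hjn
    · subst hjn
      exact hj0 (by simp [level_inl, ← hc])
    · exact hj (Option.some.inj hj')
    · simp at hj'
    · simp at hj'
  have coeff : ∀ n, g (.inl n) (.inl n) = l := by
    have h0 := (coeff_succ 0).symm.trans coeff_one
    intro n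
    induction n with
    | zero => exact h0
    | succ n ih => rw [coeff_succ, ih]
  -- The fibre of s under `step n` is s and its children. The image of e_{n+1} has no coefficient at
  -- s and that of e_n none at the children, so a child in the former must cancel s.
  have child : ∀ n s, g (.inl n) (.inr s) ≠ 0 → ∃ k, g (.inl (n + 1)) (.inr (k :: s)) ≠ 0 := by
    intro n s hs
    have hlen := (level_inr n s hs).2
    have h := inv2 (step n) (.inl (n + 1)) (.inl n) (by simp [TreeLabel.map])
    have h0 : g (.inl (n + 1)) (.inr s) = 0 := by
      by_contra h0
      have := (level_inr _ _ h0).2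
      omega
    obtain ⟨j, hj, hj', hj0⟩ := exists_ne_of_collapse_eq_zero h (i := .inr s) (k := .inr s)
      (by simp [TreeLabel.map, hlen]) (by simpa [h0] using hs)
    rcases j with j | j <;> simp only [TreeLabel.map] at hj'
    · simp at hj'
    split_ifs at hj' with hjl
    · obtain _ | ⟨k, j⟩ := j
      · simp at hjl
      obtain rfl : j = s := by simpa using hj'
      refine ⟨k, fun h1 => hj0 ?_⟩
      have h2 : g (.inl n) (.inr (k :: j)) = 0 := by
        by_contra h2
        have := (level_inr _ _ h2).2
        omega
      simp [h1, h2]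
    · exact absurd (Option.some.inj hj') hj
  have levels : ∀ n s, g (.inl n) (.inr s) = 0 := by
    intro n s
    by_contra h
    choose! f hf using child
    let b : ℕ → List ℕ := fun m => Nat.rec s (fun i t => f (n + i) t :: t) m
    have hb : ∀ m, g (.inl (n + m)) (.inr (b m)) ≠ 0 := by
      intro m
      induction m with
      | zero => exact h
      | succ m ih => exact hf _ _ ih
    exact hwf (exists_res_of_chain hT (b := b) (fun m => ⟨_, rfl⟩) fun m => (level_inr _ _ (hb m)).1)
  refine ⟨l, ?_⟩
  rintro (n | t)
  · ext (m | s)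
    · by_cases hm : m = n
      · subst hm
        simpa using coeff m
      · simpa [hm] using level_inl n m hm
    · simpa using levels n s
  · exact nodes t

theorem isRigid_treeGroup_iff {T : Set (List ℕ)} (hT : ∀ k s, k :: s ∈ T → s ∈ T) :
    IsRigid (treeGroup T) ↔ ¬ ∃ x : ℕ → ℕ, ∀ n, PiNat.res x n ∈ T :=
  ⟨fun h ⟨_, hx⟩ => not_isRigid_treeGroup hx h, isRigid_treeGroup hT⟩

/-! ### Transport to the domain ℕ -/

/-- Rigidity is invariant under isomorphism. -/
theorem IsRigid.of_addEquiv {A B : Type*} [AddCommGroup A] [AddCommGroup B] (e : A ≃+ B)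
    (h : IsRigid A) : IsRigid B := by
  refine (Set.eq_univ_of_forall fun φ => ?_).symm
  have hm : (e.trans φ).trans e.symm ∈ ({AddEquiv.refl A, AddEquiv.neg A} : Set (A ≃+ A)) :=
    h ▸ Set.mem_univ _
  have key : ∀ b, e ((e.trans φ).trans e.symm (e.symm b)) = φ b := by simp
  rcases hm with hm | hm
  · left
    ext b
    simpa [hm] using (key b).symm
  · right
    ext b
    rw [← key b, hm]
    simp

theorem isRigid_congr {A B : Type*} [AddCommGroup A] [AddCommGroup B] (e : A ≃+ B) :
    IsRigid A ↔ IsRigid B :=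
  ⟨fun h => h.of_addEquiv e, fun h => h.of_addEquiv e.symm⟩

section Transfer

variable {A : Type*} [AddCommGroup A]

theorem isTFABOp_of_equiv [IsAddTorsionFree A] (e : A ≃ ℕ) :
    IsTFABOp fun a b => e (e.symm a + e.symm b) where
  assoc a b c := by simp [add_assoc]
  comm a b := by rw [add_comm]
  exists_zero := by
    refine ⟨e 0, fun a => by simp, fun a => ⟨e (-e.symm a), by simp⟩, fun n a h => ?_⟩
    have it : ∀ k, (fun b => e (e.symm a + e.symm b))^[k] (e 0) = e (k • e.symm a) := by
      intro k
      induction k with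
      | zero => simp
      | succ k ih => rw [Function.iterate_succ_apply', ih, Equiv.symm_apply_apply, succ_nsmul']
    rw [it, e.apply_eq_iff_eq] at h
    have := (nsmul_eq_zero_iff_right n.succ_ne_zero).1 h
    rw [← this, e.apply_symm_apply]

/-- The group on `ℕ` obtained by transport of structure. -/
def TFAB.ofEquiv [IsAddTorsionFree A] (e : A ≃ ℕ) : TFAB :=
  ⟨fun a b => e (e.symm a + e.symm b), isTFABOp_of_equiv e⟩

/-- A group transported to `ℕ` is isomorphic to the original one. -/
def TFAB.ofEquivIso [IsAddTorsionFree A] (e : A ≃ ℕ) : A ≃+ (TFAB.ofEquiv e).Carrier where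
  toFun := e
  invFun := e.symm
  left_inv := e.symm_apply_apply
  right_inv := e.apply_symm_apply
  map_add' a b := by
    change e (a + b) = e (e.symm (e a) + e.symm (e b))
    simp

end Transfer

section Enumeration

variable {Q : Type*}

open Classical in
/-- The increasing enumeration of an infinite subset of a denumerable type. -/
noncomputable def enumerateEquiv (d : Q ≃ ℕ) {S : Set Q} (hS : S.Infinite) : S ≃ ℕ :=
  have hinf : (Set.ofPred fun n => d.symm n ∈ S).Infinite := by
    have : (Set.ofPred fun n => d.symm n ∈ S) = d.symm ⁻¹' S := rfl
    rw [this]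
    exact hS.preimage (by simp)
  { toFun v := Nat.count (fun n => d.symm n ∈ S) (d v)
    invFun k := ⟨d.symm (Nat.nth (fun n => d.symm n ∈ S) k), Nat.nth_mem_of_infinite hinf k⟩
    left_inv v := by
      ext1
      have hv : d.symm (d v) ∈ S := by simp
      simp [Nat.nth_count (p := fun n => d.symm n ∈ S) hv]
    right_inv k := by simp [Nat.count_nth_of_infinite hinf] }

open Classical in
theorem enumerateEquiv_apply (d : Q ≃ ℕ) {S : Set Q} (hS : S.Infinite) (v : S) :
    enumerateEquiv d hS v = Nat.count (fun n => d.symm n ∈ S) (d v) := rfl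

theorem enumerateEquiv_symm_eq_iff (d : Q ≃ ℕ) {S : Set Q} (hS : S.Infinite) (k : ℕ) (q : Q) :
    ((enumerateEquiv d hS).symm k : Q) = q ↔ ∃ h : q ∈ S, enumerateEquiv d hS ⟨q, h⟩ = k := by
  constructor
  · rintro rfl
    exact ⟨Subtype.prop _, by simp⟩
  · rintro ⟨h, rfl⟩
    simp

open Classical in
theorem measurable_count {Y : Type*} [MeasurableSpace Y] {P : Y → ℕ → Prop}
    (hP : ∀ n, MeasurableSet {y | P y n}) (n : ℕ) : Measurable fun y => Nat.count (P y) n := by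
  induction n with
  | zero => simp
  | succ n ih =>
    simp only [Nat.count_succ]
    exact ih.add (Measurable.ite (hP n) measurable_const measurable_const)

/-- A measurable family of infinite subgroups of a countable torsion-free group yields a
measurable family of elements of `TFAB`. -/
theorem measurable_ofEquiv_enumerate [AddCommGroup Q] [IsAddTorsionFree Q] (d : Q ≃ ℕ)
    {Y : Type*} [MeasurableSpace Y] {H : Y → AddSubgroup Q}
    (hinf : ∀ y, (H y : Set Q).Infinite) (hH : ∀ q, MeasurableSet {y | q ∈ H y}) :
    Measurable fun y => TFAB.ofEquiv (A := H y) (enumerateEquiv d (hinf y)) := by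
  classical
  have hcount : Measurable fun y => Nat.count (fun n => d.symm n ∈ H y) :=
    measurable_pi_lambda _ fun n => measurable_count (fun n => hH (d.symm n)) n
  let t : ℕ → Y → ℕ := fun a y => d ((enumerateEquiv d (hinf y)).symm a : Q)
  have ht : ∀ a, Measurable (t a) := by
    intro a
    refine measurable_to_countable' fun k => ?_
    -- The a-th element has code k exactly when k codes an element of the subgroup and a smaller
    -- codes do so.
    have : t a ⁻¹' {k} = {y | d.symm k ∈ H y} ∩
        {y | Nat.count (fun n => d.symm n ∈ H y) k = a} := by
      ext y
      have h1 := enumerateEquiv_symm_eq_iff d (hinf y) a (d.symm k)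
      rw [Equiv.eq_symm_apply] at h1
      refine h1.trans ?_
      simp only [enumerateEquiv_apply, Equiv.apply_symm_apply, exists_prop]
      rfl
    rw [this]
    exact (hH _).inter (measurableSet_eq_fun (measurable_count (fun n => hH (d.symm n)) k)
      measurable_const)
  refine Measurable.subtype_mk (measurable_pi_lambda _ fun a => measurable_pi_lambda _ fun b => ?_)
  have hsum : Measurable fun y => d (d.symm (t a y) + d.symm (t b y)) :=
    (Measurable.of_discrete (f := fun x : ℕ × ℕ => d (d.symm x.1 + d.symm x.2))).comp
      ((ht a).prodMk (ht b))
  convert measurable_apply_nat hcount hsum using 2 with y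
  simp only [t, Equiv.symm_apply_apply]
  exact enumerateEquiv_apply d (hinf y) _

end Enumeration

/-! ### Borel families of trees and their groups -/

theorem measurableSet_mem_treeGroup {Y : Type*} [MeasurableSpace Y] {T : Y → Set (List ℕ)}
    (hT : ∀ s, MeasurableSet {y | s ∈ T y}) (q : ℕ ⊕ List ℕ →₀ ℚ) :
    MeasurableSet {y | q ∈ treeGroup (T y)} := by
  simp only [mem_collapseGroup, Set.ofPred_forall]
  refine MeasurableSet.iInter fun j => MeasurableSet.iInter fun i => ?_
  have : ∀ κ : ℕ ⊕ List ℕ → Option (ℕ ⊕ List ℕ), ∀ k, collapse κ q k =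
      ∑ a ∈ q.support, if κ a = some k then q a else 0 := by
    intro κ k
    rw [collapse, Finsupp.linearCombination_apply, Finsupp.sum, Finsupp.finsetSum_apply]
    refine Finset.sum_congr rfl fun a _ => ?_
    cases κ a <;> simp [Finsupp.single_apply]
  simp only [this]
  have hmap : ∀ a k, MeasurableSet {y | TreeLabel.map (T y) j a = some k} := by
    intro a k
    classical
    rcases j with t | t | n | n | _ <;> rcases a with m | s <;>
      simp only [TreeLabel.map, MeasurableSet.const]
    -- Only a `level` label evaluated at a sequence depends on the tree.
    have h1 : MeasurableSet {y | s ∈ T y ∧ s.length = n} := (hT s).inter (MeasurableSet.const _)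
    simp only [ite_eq_iff, reduceCtorEq, and_false, false_or]
    exact h1.compl.inter (MeasurableSet.const _)
  have hm : Measurable fun y =>
      ∑ a ∈ q.support, if TreeLabel.map (T y) j a = some i then q a else 0 :=
    Finset.measurable_fun_sum _ fun a _ =>
      Measurable.ite (hmap a i) measurable_const measurable_const
  exact hm (MeasurableSet.of_discrete (s := {r | r ∈ primeIntegral (TreeLabel.prime j)}))

theorem treeGroup_infinite (T : Set (List ℕ)) :
    (treeGroup T : Set (ℕ ⊕ List ℕ →₀ ℚ)).Infinite :=
  (Set.infinite_range_of_injective (f := fun i : ℕ ⊕ List ℕ => (Finsupp.single i 1 : _ →₀ ℚ))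
    (Finsupp.single_left_injective one_ne_zero)).mono
    (Set.range_subset_iff.2 fun i => single_mem_collapseGroup i)

/-- Every analytic set is given by the branches of a measurable family of trees. -/
theorem IsAnalytic.exists_trees {Y : Type*} [MeasurableSpace Y] {A : Set Y} (hA : IsAnalytic A) :
    ∃ T : Y → Set (List ℕ), (∀ s, MeasurableSet {y | s ∈ T y}) ∧
      (∀ y k s, k :: s ∈ T y → s ∈ T y) ∧
      ∀ y, y ∈ A ↔ ∃ x : ℕ → ℕ, ∀ n, PiNat.res x n ∈ T y := by
  obtain ⟨_, _, _, hA⟩ := hA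
  rw [AnalyticSet] at hA
  rcases hA with rfl | ⟨f, hf, rfl⟩
  · exact ⟨fun _ => ∅, by simp, by simp, by simp⟩
  -- Closures make membership of each s a closed condition on y. They add no spurious branch: if f x
  -- ≠ y, continuity sends a cylinder around x into an open set disjoint from a neighbourhood of y.
  refine ⟨fun y => {s | y ∈ closure (f '' {x | PiNat.res x s.length = s})},
    fun s => isClosed_closure.measurableSet, fun y k s h => ?_, fun y => ?_⟩
  · refine closure_mono (Set.image_mono fun x hx => ?_) h
    have : x s.length :: PiNat.res x s.length = k :: s := hx
    exact (List.cons.inj this).2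
  · constructor
    · rintro ⟨x, rfl⟩
      exact ⟨x, fun n => subset_closure ⟨x, by simp [PiNat.res_length], rfl⟩⟩
    · rintro ⟨x, hx⟩
      refine ⟨x, ?_⟩
      by_contra hne
      obtain ⟨U, V, hU, hV, hxU, hyV, hUV⟩ := t2_separation hne
      obtain ⟨_, ⟨z, n, rfl⟩, hxn, hn⟩ := (PiNat.isTopologicalBasis_cylinders
        (fun _ : ℕ => ℕ)).exists_subset_of_mem_open (show x ∈ f ⁻¹' U from hxU) (hU.preimage hf)
      obtain ⟨_, hwV, w, hw, rfl⟩ := mem_closure_iff.1 (hx n) V hV hyV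
      have hwn : w ∈ PiNat.cylinder z n := by
        rw [← PiNat.mem_cylinder_iff_eq.1 hxn, PiNat.cylinder_eq_res]
        simpa [PiNat.res_length] using hw
      exact Set.disjoint_left.1 hUV (hn hwn) hwV

/-! ### Co-analyticity and completeness -/

/-- The witness carries the inverse map, and φ a ≠ -a is written as φ a + (a + a) ≠ a, so that only
the addition table appears and the matrix is visibly Borel. -/
theorem not_isRigid_iff (G : TFAB) : ¬ IsRigid G.Carrier ↔ ∃ f : (ℕ → ℕ) × (ℕ → ℕ),
    (∀ n, f.1 (f.2 n) = n) ∧ (∀ n, f.2 (f.1 n) = n) ∧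
    (∀ a b, f.1 (G.1 a b) = G.1 (f.1 a) (f.1 b)) ∧ (∃ a, f.1 a ≠ a) ∧
    ∃ a, G.1 (f.1 a) (G.1 a a) ≠ a := by
  have hneg : ∀ a b : G.Carrier, b + (a + a) = a ↔ b = -a := by
    intro a b
    rw [← add_assoc, add_eq_right, eq_neg_iff_add_eq_zero]
  constructor
  · intro h
    have h' : ∃ φ : G.Carrier ≃+ G.Carrier, φ ∉ ({AddEquiv.refl _, AddEquiv.neg _} :
        Set (G.Carrier ≃+ G.Carrier)) := by
      by_contra! h'
      exact h (Set.eq_univ_of_forall h').symm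
    obtain ⟨φ, hφ⟩ := h'
    simp only [Set.mem_insert_iff, Set.mem_singleton_iff, not_or] at hφ
    refine ⟨(φ, φ.symm), φ.apply_symm_apply, φ.symm_apply_apply, φ.map_add, ?_, ?_⟩
    · by_contra! h
      exact hφ.1 (AddEquiv.ext h)
    · by_contra! h
      exact hφ.2 (AddEquiv.ext fun a => (hneg a (φ a)).1 (h a))
  · rintro ⟨f, h1, h2, h3, ⟨a, ha⟩, b, hb⟩ h
    let φ : G.Carrier ≃+ G.Carrier :=
      { toFun := f.1, invFun := f.2, left_inv := h2, right_inv := h1, map_add' := h3 }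
    have hm : φ ∈ ({AddEquiv.refl _, AddEquiv.neg _} : Set (G.Carrier ≃+ G.Carrier)) :=
      h ▸ Set.mem_univ φ
    rcases hm with hm | hm
    · exact ha (DFunLike.congr_fun hm a)
    · exact hb ((hneg b (φ b)).2 (DFunLike.congr_fun hm b))

theorem MeasurableSet.isAnalytic_image_fst {X Z : Type*} [MeasurableSpace X]
    [StandardBorelSpace X] [MeasurableSpace Z] [StandardBorelSpace Z] {S : Set (X × Z)}
    (hS : MeasurableSet S) : IsAnalytic (Prod.fst '' S) := by
  let _ := upgradeStandardBorel X
  exact ⟨inferInstance, inferInstance, inferInstance, hS.analyticSet_image measurable_fst⟩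

theorem isCoanalytic_isRigid : IsCoanalytic {G : TFAB | IsRigid G.Carrier} := by
  let S : Set (TFAB × (ℕ → ℕ) × (ℕ → ℕ)) := {x |
    (∀ n, x.2.1 (x.2.2 n) = n) ∧ (∀ n, x.2.2 (x.2.1 n) = n) ∧
    (∀ a b, x.2.1 (x.1.1 a b) = x.1.1 (x.2.1 a) (x.2.1 b)) ∧ (∃ a, x.2.1 a ≠ a) ∧
    ∃ a, x.1.1 (x.2.1 a) (x.1.1 a a) ≠ a}
  have hS : MeasurableSet S := by
    have hm : Measurable fun x : TFAB × (ℕ → ℕ) × (ℕ → ℕ) => x.1.1 :=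
      measurable_subtype_coe.comp measurable_fst
    have hf : Measurable fun x : TFAB × (ℕ → ℕ) × (ℕ → ℕ) => x.2.1 := by fun_prop
    have hg : Measurable fun x : TFAB × (ℕ → ℕ) × (ℕ → ℕ) => x.2.2 := by fun_prop
    have ap : ∀ (a : ℕ) {g : TFAB × (ℕ → ℕ) × (ℕ → ℕ) → ℕ → ℕ}, Measurable g →
        Measurable fun x => g x a := fun a _ hg => (measurable_pi_apply a).comp hg
    have op : ∀ {g h : TFAB × (ℕ → ℕ) × (ℕ → ℕ) → ℕ}, Measurable g → Measurable h →
        Measurable fun x : TFAB × (ℕ → ℕ) × (ℕ → ℕ) => x.1.1 (g x) (h x) := by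
      intro g h hg hh
      have hp : Measurable fun p : ℕ × (ℕ → ℕ → ℕ) => p.2 p.1 :=
        measurable_from_prod_countable_right fun n => measurable_pi_apply n
      exact measurable_apply_nat (hp.comp (hg.prodMk hm)) hh
    have eq : ∀ {g h : TFAB × (ℕ → ℕ) × (ℕ → ℕ) → ℕ}, Measurable g → Measurable h →
        Measurable fun x => g x = h x := fun hf hg =>
      measurableSet_setOfPred.1 (measurableSet_eq_fun hf hg)
    refine measurableSet_setOfPred.2 (.and (.forall fun n => ?_) (.and (.forall fun n => ?_)
      (.and (.forall fun a => .forall fun b => ?_) (.and (.exists fun a => .not ?_)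
        (.exists fun a => .not ?_)))))
    · exact eq (measurable_apply_nat hf (ap n hg)) measurable_const
    · exact eq (measurable_apply_nat hg (ap n hf)) measurable_const
    · exact eq (measurable_apply_nat hf (op measurable_const measurable_const))
        (op (ap a hf) (ap b hf))
    · exact eq (ap a hf) measurable_const
    · exact eq (op (ap a hf) (op measurable_const measurable_const)) measurable_const
  have : {G : TFAB | IsRigid G.Carrier}ᶜ = Prod.fst '' S := by
    ext G
    rw [Set.mem_compl_iff, Set.mem_ofPred_eq, not_isRigid_iff]
    constructor
    · rintro ⟨f, hf⟩
      exact ⟨(G, f), hf, rfl⟩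
    · rintro ⟨⟨_, f⟩, hf, rfl⟩
      exact ⟨f, hf⟩
  rw [IsCoanalytic, this]
  exact hS.isAnalytic_image_fst

theorem theorem1p3 :
    IsCompleteCoanalytic.{0, v} {G : TFAB | IsRigid G.Carrier} := by
  refine ⟨isCoanalytic_isRigid, fun Y _ _ B hB => ?_⟩
  -- The trees belong to the complement of B: a branch exists exactly when y is outside B.
  obtain ⟨T, hT, htail, hbranch⟩ := IsAnalytic.exists_trees hB
  obtain ⟨d⟩ : Nonempty ((ℕ ⊕ List ℕ →₀ ℚ) ≃ ℕ) := nonempty_equiv_of_countable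
  refine ⟨_, measurable_ofEquiv_enumerate d (H := fun y => treeGroup (T y))
    (fun y => treeGroup_infinite (T y)) (measurableSet_mem_treeGroup hT), ?_⟩
  ext y
  have h1 := isRigid_congr (TFAB.ofEquivIso (A := treeGroup (T y))
    (enumerateEquiv d (treeGroup_infinite (T y))))
  refine h1.symm.trans ((isRigid_treeGroup_iff (htail y)).trans ?_)
  rw [← hbranch, Set.mem_compl_iff, not_not]
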